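/- For integers $n\ge 4$ and $2\le k\le n-2$, let $P=P_{n,k}$ be the transition matrix on $V=\{1,2,\dots,n\}$ given by $P(v,v+1)=\tfrac12$ for $1\le v\le n-1$, $P(n,1)=\tfrac12$, $P(v,v)=\tfrac12$ for $v\in V\setminus\{k,n\}$, $P(k,k)=P(k,n)=P(n,k)=P(n,n)=\tfrac14$, and all other entries $0$. (This is a Markov chain with clockwise drift on the $n$-cycle with the single extra edge $\{k,n\}$; $P$ is doubly stochastic and its unique stationary distribution is uniform.) Let $$d_{n,k}(t)=\max_{x\in V}\ \max_{S\subseteq V}\Big|P^t(x,S)-\frac{|S|}{n}\Big|,\qquad t_{\rm mix}^{n,k}(\varepsilon)=\min\{t\in\{0,1,2,\dots\}: d_{n,k}(t)\le\varepsilon\}$$ be the maximal total variation distance from the uniform distribution at time $t$ and the mixing time. Theorem. There exist constants $\gamma^*>0$, $\varepsilon^*>0$ and $n_0$ such that for every $n\ge n_0$ and every integer $k$ with $2\le k\le n-2$, $$t_{\rm mix}^{n,k}(\varepsilon^*)\ \ge\ \gamma^*\, n^{3/2}.$$ -/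

import Mathlib

namespace CycleChain

/-- The vertex set `V = {1, 2, …, n}` of the cycle. -/
abbrev Vertex (n : ℕ) : Type := {v : ℕ // v ∈ Finset.Icc 1 n}

/-- `w` is the clockwise successor of `v` on the cycle `1 → 2 → ⋯ → n → 1`. -/
def IsNext (n : ℕ) (v w : Vertex n) : Prop :=
  (w : ℕ) = (v : ℕ) + 1 ∨ ((v : ℕ) = n ∧ (w : ℕ) = 1)

/-- The hubs are the two endpoints `k` and `n` of the extra edge. -/
def IsHub (n k : ℕ) (v : Vertex n) : Prop :=
  (v : ℕ) = k ∨ (v : ℕ) = n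

open Classical in
/-- The transition matrix. In the arc notation `a_i = i` (`1 ≤ i ≤ k`) and `b_j = k + j`
(`1 ≤ j ≤ n - k`), the first case consists of `a_i → a_{i+1}`, `b_j → b_{j+1}`, `a_k → b_1`
and `b_{n-k} → a_1`; the second case consists of the four transitions among the hubs
`a_k`, `b_{n-k}`; the third case consists of the loops at the other vertices. -/
noncomputable def transition (n k : ℕ) : Matrix (Vertex n) (Vertex n) ℝ :=
  Matrix.of fun v w =>
    if IsNext n v w then 1 / 2
    else if IsHub n k v ∧ IsHub n k w then 1 / 4
    else if v = w then 1 / 2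
    else 0

/-- The law of `X(t)` for the chain started at `X(0) = x`. -/
noncomputable def law (n k t : ℕ) (x : Vertex n) : Vertex n → ℝ :=
  fun y => (transition n k ^ t) x y

/-- The uniform distribution on the vertices. -/
noncomputable def uniform (n : ℕ) : Vertex n → ℝ :=
  fun _ => 1 / (n : ℝ)

/-- The total variation distance `sup_{S ⊆ V} |μ(S) - σ(S)|`. -/
noncomputable def tvDist {V : Type} (μ σ : V → ℝ) : ℝ :=
  ⨆ S : Finset V, |∑ x ∈ S, μ x - ∑ x ∈ S, σ x|

/-- The maximal distance from uniform at time `t`, over all starting vertices. -/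
noncomputable def maxDist (n k t : ℕ) : ℝ :=
  ⨆ x : Vertex n, tvDist (law n k t x) (uniform n)

/-- The mixing time `min {t : d(t) ≤ ε}`. -/
noncomputable def mixingTime (n k : ℕ) (ε : ℝ) : ℕ :=
  sInf {t : ℕ | maxDist n k t ≤ ε}

end CycleChain

/-!
Each step of the chain applies to the current vertex one of three permutations: the clockwise
shift with probability `1 / 2`, the identity with probability `1 / 4`, and the exchange of the two
hubs with probability `1 / 4` (`transition_apply`). Let `s` be the number of clockwise moves up to
time `t`, and `j` the number of jumps `k → n` minus the number of jumps `n → k`. A chain started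
at `x` is then at `x + s + (n - k) j` modulo `n`, so a set of pairs `(s, j)` carrying most of the
mass yields a set of vertices, no larger, carrying most of the mass.

The count `s` is exactly binomial `(t, 1 / 2)`, hence has variance `t / 4`. The count `j` becomes a
martingale after adding `1 / 3` on the arc `1, …, k`, and this martingale moves only at the hubs.
By stationarity of the uniform law some starting vertex expects at most `2 t / n` visits to the
hubs, which bounds the variance by `t / (3 n)`; see `step_iterate_sq` and `exists_few_hub_visits`.
So by Chebyshev's inequality most of the mass at time `t` lies on a set of about
`√t · (√(t / n) + 1)` vertices (`exists_law_reach`). For `t ≤ γ n ^ (3 / 2)` with `γ` small this is at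
most half of the vertices, and the law is far from uniform (`lt_maxDist`).

Expectations are handled without a probability space: `step` is the averaging operator of the
chain `(X, s, j)`, and its iterates are evaluated in closed form. Since the mixing time is an
infimum of natural numbers, it must also be known that the distance does fall below the
threshold; this is the Doeblin argument in `exists_maxDist_le`.
-/

namespace CycleChain

open Finset

/-! ### The chain as a mixture of permutations -/

/-- The clockwise successor on the cycle, as a function. -/
def next {n : ℕ} (v : Vertex n) : Vertex n :=
  ⟨if (v : ℕ) = n then 1 else (v : ℕ) + 1, by
    have := Finset.mem_Icc.1 v.2
    split_ifs <;> simp only [Finset.mem_Icc] <;> omega⟩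

lemma next_val {n : ℕ} (v : Vertex n) :
    (next v : ℕ) = if (v : ℕ) = n then 1 else (v : ℕ) + 1 := rfl

lemma next_bijective {n : ℕ} : Function.Bijective (next : Vertex n → Vertex n) := by
  apply Finite.injective_iff_bijective.1
  intro v w h
  have hv := Finset.mem_Icc.1 v.2
  have hw := Finset.mem_Icc.1 w.2
  have h' := congrArg Subtype.val h
  simp only [next_val] at h'
  apply Subtype.ext
  split_ifs at h' <;> omega

/-- The involution of the vertices that exchanges the two hubs. -/
def mate {n k : ℕ} (hk : 2 ≤ k) (hn : k + 2 ≤ n) : Equiv.Perm (Vertex n) :=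
  Equiv.swap ⟨k, Finset.mem_Icc.2 (by omega)⟩ ⟨n, Finset.mem_Icc.2 (by omega)⟩

lemma mate_val {n k : ℕ} (hk : 2 ≤ k) (hn : k + 2 ≤ n) (v : Vertex n) :
    (mate hk hn v : ℕ) = if (v : ℕ) = k then n else if (v : ℕ) = n then k else v := by
  simp only [mate, Equiv.swap_apply_def, Subtype.ext_iff]
  split_ifs <;> rfl

/-- The transition matrix is the convex combination `½ next + ¼ id + ¼ mate` of permutations. -/
lemma transition_apply {n k : ℕ} (hk : 2 ≤ k) (hn : k + 2 ≤ n) (v w : Vertex n) :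
    transition n k v w = (if w = next v then 1 / 2 else 0) + (if w = v then 1 / 4 else 0)
      + (if w = mate hk hn v then 1 / 4 else 0) := by
  have hv := Finset.mem_Icc.1 v.2
  have hw := Finset.mem_Icc.1 w.2
  simp only [transition, Matrix.of_apply, IsNext, IsHub, Subtype.ext_iff, mate_val, next_val]
  obtain ⟨v, hv'⟩ := v
  obtain ⟨w, hw'⟩ := w
  simp only at hv hw ⊢
  split_ifs <;> first | omega | norm_num

lemma transition_mulVec {n k : ℕ} (hk : 2 ≤ k) (hn : k + 2 ≤ n) (g : Vertex n → ℝ)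
    (v : Vertex n) :
    (transition n k).mulVec g v
      = 1 / 2 * g (next v) + 1 / 4 * g v + 1 / 4 * g (mate hk hn v) := by
  simp [Matrix.mulVec, dotProduct, transition_apply hk hn, add_mul, sum_add_distrib, ite_mul]

lemma sum_transition_mulVec {n k : ℕ} (hk : 2 ≤ k) (hn : k + 2 ≤ n) (g : Vertex n → ℝ) :
    ∑ v, (transition n k).mulVec g v = ∑ v, g v := by
  simp only [transition_mulVec hk hn, sum_add_distrib, ← mul_sum]
  rw [next_bijective.sum_comp g, Equiv.sum_comp (mate hk hn) g]
  ring

lemma sum_transition_pow_mulVec {n k : ℕ} (hk : 2 ≤ k) (hn : k + 2 ≤ n) (g : Vertex n → ℝ)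
    (t : ℕ) : ∑ v, (transition n k ^ t).mulVec g v = ∑ v, g v := by
  induction t with
  | zero => simp
  | succ t ih =>
    rw [← ih, pow_succ', ← Matrix.mulVec_mulVec, sum_transition_mulVec hk hn]

lemma transition_mulVec_one {n k : ℕ} (hk : 2 ≤ k) (hn : k + 2 ≤ n) (t : ℕ) :
    (transition n k ^ t).mulVec 1 = 1 := by
  induction t with
  | zero => simp
  | succ t ih =>
    rw [pow_succ', ← Matrix.mulVec_mulVec, ih]
    ext v
    rw [transition_mulVec hk hn]
    norm_num

/-- Probabilities under the law at time `t` are values of the iterated averaging operator. -/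
lemma sum_law_eq_mulVec_indicator {n k t : ℕ} (S : Finset (Vertex n)) (x : Vertex n) :
    ∑ y ∈ S, law n k t x y
      = (transition n k ^ t).mulVec (fun v => if v ∈ S then 1 else 0) x := by
  simp only [law, Matrix.mulVec, dotProduct, mul_ite, mul_one, mul_zero, sum_ite_mem, univ_inter]

lemma sum_uniform {n : ℕ} (S : Finset (Vertex n)) :
    ∑ x ∈ S, uniform n x = (S.card : ℝ) / n := by
  simp [uniform, div_eq_mul_inv]

lemma card_vertex (n : ℕ) : Fintype.card (Vertex n) = n := by
  simp [Vertex]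

/-! ### Winding and jump counts -/

/-- The signed number of hub jumps made by applying `mate` at `v`: `k → n` counts as `+1` and
`n → k` as `-1`. -/
def jump {n : ℕ} (k : ℕ) (v : Vertex n) : ℤ :=
  if (v : ℕ) = k then 1 else if (v : ℕ) = n then -1 else 0

/-- The corrector: adding it to the signed jump count gives a martingale. -/
noncomputable def corrector {n : ℕ} (k : ℕ) (v : Vertex n) : ℝ :=
  if (v : ℕ) ≤ k then 1 / 3 else 0

lemma corrector_next {n k : ℕ} (hk : 2 ≤ k) (hn : k + 2 ≤ n) (v : Vertex n) :
    corrector k (next v) = corrector k v - jump k v / 3 := by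
  have hv := Finset.mem_Icc.1 v.2
  simp only [corrector, jump, next_val]
  split_ifs <;> first | omega | norm_num

lemma corrector_mate {n k : ℕ} (hk : 2 ≤ k) (hn : k + 2 ≤ n) (v : Vertex n) :
    corrector k (mate hk hn v) = corrector k v - jump k v / 3 := by
  have hv := Finset.mem_Icc.1 v.2
  simp only [corrector, jump, mate_val]
  split_ifs <;> first | omega | norm_num

/-- The averaging operator of the chain `(X, s, j)`, in which `s` counts the clockwise moves of
`X` and `j` its signed hub jumps. -/
noncomputable def step {n k : ℕ} (hk : 2 ≤ k) (hn : k + 2 ≤ n) (f : Vertex n → ℤ → ℤ → ℝ) :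
    Vertex n → ℤ → ℤ → ℝ :=
  fun v s j => 1 / 2 * f (next v) (s + 1) j + 1 / 4 * f v s j
    + 1 / 4 * f (mate hk hn v) s (j + jump k v)

lemma step_iterate_vertex {n k : ℕ} (hk : 2 ≤ k) (hn : k + 2 ≤ n) (g : Vertex n → ℝ) (t : ℕ) :
    (step hk hn)^[t] (fun v _ _ => g v) = fun v _ _ => (transition n k ^ t).mulVec g v := by
  induction t with
  | zero => simp
  | succ t ih =>
    rw [Function.iterate_succ_apply', ih]
    funext v s j
    rw [pow_succ', ← Matrix.mulVec_mulVec, transition_mulVec hk hn]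
    rfl

/-- The relation `v = x + s + (n - k) j` modulo `n`, which the chain started at `(x, 0, 0)`
never leaves. -/
def Tracks {n : ℕ} (k : ℕ) (x v : Vertex n) (s j : ℤ) : Prop :=
  (n : ℤ) ∣ (v : ℤ) - x - s - (n - k) * j

lemma Tracks.next {n k : ℕ} {x v : Vertex n} {s j : ℤ} (h : Tracks k x v s j) :
    Tracks k x (next v) (s + 1) j := by
  unfold Tracks at *
  rw [next_val]
  split_ifs with hv
  · have : ((1 : ℕ) : ℤ) - x - (s + 1) - (n - k) * j
        = ((v : ℤ) - x - s - (n - k) * j) - n := by rw [hv]; push_cast; ring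
    rw [this]
    exact dvd_sub_self_right.2 h
  · convert h using 1
    push_cast; ring

lemma Tracks.mate {n k : ℕ} (hk : 2 ≤ k) (hn : k + 2 ≤ n) {x v : Vertex n} {s j : ℤ}
    (h : Tracks k x v s j) : Tracks k x (mate hk hn v) s (j + jump k v) := by
  unfold Tracks at *
  rw [mate_val, jump]
  split_ifs with h1 h2
  · convert h using 1
    rw [h1]; ring
  · convert h using 1
    rw [h2]; ring
  · simpa using h

lemma step_iterate_le {n k : ℕ} (hk : 2 ≤ k) (hn : k + 2 ≤ n) (x : Vertex n)
    {f g : Vertex n → ℤ → ℤ → ℝ} (hfg : ∀ v s j, Tracks k x v s j → f v s j ≤ g v s j) (t : ℕ) :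
    ∀ v s j, Tracks k x v s j → (step hk hn)^[t] f v s j ≤ (step hk hn)^[t] g v s j := by
  induction t with
  | zero => simpa using hfg
  | succ t ih =>
    intro v s j h
    simp only [Function.iterate_succ_apply', step]
    linarith [ih _ _ _ h, ih _ _ _ h.next, ih _ _ _ (h.mate hk hn)]

/-- Second moments: the number of clockwise moves is binomial `(t, ½)`, and the corrected jump
count is a martingale whose squared increments have conditional mean `jump² / 6`. -/
lemma step_iterate_sq {n k : ℕ} (hk : 2 ≤ k) (hn : k + 2 ≤ n) (a b c m : ℝ) (t : ℕ) :
    (step hk hn)^[t] (fun v (s j : ℤ) => a * ((s : ℝ) - c) ^ 2 + b * ((j : ℝ) + corrector k v - m) ^ 2)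
      = fun v (s j : ℤ) => a * (((s : ℝ) - c + t / 2) ^ 2 + t / 4)
        + b * (((j : ℝ) + corrector k v - m) ^ 2
          + 1 / 6 * ∑ i ∈ range t,
            (transition n k ^ i).mulVec (fun w => (jump k w : ℝ) ^ 2) v) := by
  induction t with
  | zero => simp
  | succ t ih =>
    rw [Function.iterate_succ_apply', ih]
    funext v s j
    have hsum : ∑ i ∈ range (t + 1),
          (transition n k ^ i).mulVec (fun w => (jump k w : ℝ) ^ 2) v
        = 1 / 2 * (∑ i ∈ range t,
            (transition n k ^ i).mulVec (fun w => (jump k w : ℝ) ^ 2) (next v))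
          + 1 / 4 * (∑ i ∈ range t,
            (transition n k ^ i).mulVec (fun w => (jump k w : ℝ) ^ 2) v)
          + 1 / 4 * (∑ i ∈ range t,
            (transition n k ^ i).mulVec (fun w => (jump k w : ℝ) ^ 2) (mate hk hn v))
          + (jump k v : ℝ) ^ 2 := by
      rw [sum_range_succ', mul_sum, mul_sum, mul_sum, ← sum_add_distrib, ← sum_add_distrib]
      congr 1
      · refine sum_congr rfl fun i _ => ?_
        rw [pow_succ', ← Matrix.mulVec_mulVec, transition_mulVec hk hn]
      · simp
    simp only [step]
    rw [hsum, corrector_next hk hn, corrector_mate hk hn]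
    push_cast
    ring

lemma sum_jump_sq {n k : ℕ} (hk : 2 ≤ k) (hn : k + 2 ≤ n) :
    ∑ v : Vertex n, (jump k v : ℝ) ^ 2 = 2 := by
  have : ∀ v : Vertex n, (jump k v : ℝ) ^ 2
      = (if v = ⟨k, Finset.mem_Icc.2 (by omega)⟩ then 1 else 0)
        + (if v = ⟨n, Finset.mem_Icc.2 (by omega)⟩ then 1 else 0) := by
    intro v
    simp only [jump, Subtype.ext_iff]
    split_ifs <;> first | omega | norm_num
  simp only [this, sum_add_distrib, sum_ite_eq', mem_univ, if_true]
  norm_num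

/-- By stationarity of the uniform law, some starting vertex expects at most `2 t / n` hub visits
before time `t`. -/
lemma exists_few_hub_visits {n k : ℕ} (hk : 2 ≤ k) (hn : k + 2 ≤ n) (t : ℕ) :
    ∃ x : Vertex n, ∑ i ∈ range t,
      (transition n k ^ i).mulVec (fun w => (jump k w : ℝ) ^ 2) x ≤ 2 * t / n := by
  have hn0 : (n : ℝ) ≠ 0 := by
    have : n ≠ 0 := by omega
    exact_mod_cast this
  have hne : (univ : Finset (Vertex n)).Nonempty :=
    ⟨⟨n, Finset.mem_Icc.2 (by omega)⟩, mem_univ _⟩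
  obtain ⟨x, -, hx⟩ := exists_le_of_sum_le (s := (univ : Finset (Vertex n)))
    (f := fun x => ∑ i ∈ range t,
      (transition n k ^ i).mulVec (fun w => (jump k w : ℝ) ^ 2) x)
    (g := fun _ => 2 * (t : ℝ) / n) hne (by
      rw [sum_comm]
      simp only [sum_transition_pow_mulVec hk hn, sum_jump_sq hk hn, sum_const, card_univ,
        card_vertex, card_range, nsmul_eq_mul]
      apply le_of_eq
      field_simp)
  exact ⟨x, hx⟩

/-! ### The small set that carries most of the mass -/

/-- The integers at distance less than `r` from `c`. -/
noncomputable def intBall (c r : ℝ) : Finset ℤ := Finset.Icc ⌈c - r⌉ ⌊c + r⌋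

lemma mem_intBall {c r : ℝ} {z : ℤ} (h : |(z : ℝ) - c| < r) : z ∈ intBall c r := by
  rw [abs_lt] at h
  simp only [intBall, Finset.mem_Icc, Int.ceil_le, Int.le_floor]
  constructor <;> linarith

lemma card_intBall_le {c r : ℝ} (hr : 0 ≤ r) : ((intBall c r).card : ℝ) ≤ 2 * r + 1 := by
  have h1 := Int.le_ceil (c - r)
  have h2 := Int.floor_le (c + r)
  rw [intBall, Int.card_Icc]
  have : (((⌊c + r⌋ + 1 - ⌈c - r⌉).toNat : ℤ) : ℝ)
      ≤ max ((⌊c + r⌋ + 1 - ⌈c - r⌉ : ℤ) : ℝ) 0 := by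
    rw [Int.toNat_eq_max]; push_cast; exact le_rfl
  refine (le_trans (by push_cast; exact le_rfl) this).trans (max_le ?_ (by linarith))
  push_cast
  linarith

open Classical in
/-- The vertices reached from `x` with `s ∈ A` clockwise moves and `j ∈ B` signed hub jumps. -/
noncomputable def reach {n : ℕ} (k : ℕ) (x : Vertex n) (A B : Finset ℤ) : Finset (Vertex n) :=
  (univ : Finset (Vertex n)).filter fun v : Vertex n => ∃ s ∈ A, ∃ j ∈ B, Tracks k x v s j

lemma mem_reach {n k : ℕ} {x v : Vertex n} {A B : Finset ℤ} :
    v ∈ reach k x A B ↔ ∃ s ∈ A, ∃ j ∈ B, Tracks k x v s j := by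
  simp [reach]

lemma card_reach_le {n : ℕ} (k : ℕ) (x : Vertex n) (A B : Finset ℤ) :
    (reach k x A B).card ≤ A.card * B.card := by
  have h : ∀ v ∈ reach k x A B, ∃ p ∈ A ×ˢ B, Tracks k x v p.1 p.2 := by
    intro v hv
    obtain ⟨s, hs, j, hj, h⟩ := mem_reach.1 hv
    exact ⟨(s, j), mem_product.2 ⟨hs, hj⟩, h⟩
  choose! p hp hpt using h
  rw [← card_product]
  refine card_le_card_of_injOn p hp ?_
  intro v hv w hw hvw
  have h1 := hpt v hv
  have h2 := hpt w hw
  rw [hvw] at h1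
  have hd := dvd_sub h1 h2
  have hv' := Finset.mem_Icc.1 v.2
  have hw' := Finset.mem_Icc.1 w.2
  apply Subtype.ext
  have he : ((v : ℕ) : ℤ) - (w : ℕ) = 0 := by
    refine Int.eq_zero_of_abs_lt_dvd (m := n) ?_ ?_
    · have e : ((v : ℕ) : ℤ) - (w : ℕ) = ((v : ℤ) - x - (p w).1 - (n - k) * (p w).2)
          - ((w : ℤ) - x - (p w).1 - (n - k) * (p w).2) := by ring
      exact e ▸ hd
    · rw [abs_lt]; omega
  omega

/-- Chebyshev's inequality for both counts, from a suitable starting vertex. The radius for the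
jumps exceeds `b` by `1 / 3` because the corrector varies by that much. -/
lemma exists_law_reach {n k : ℕ} (hk : 2 ≤ k) (hn : k + 2 ≤ n) (t : ℕ) {a b : ℝ} (ha : 0 < a)
    (hb : 0 < b) :
    ∃ x : Vertex n, 1 - t / (4 * a ^ 2) - t / (3 * n * b ^ 2)
      ≤ ∑ y ∈ reach k x (intBall (t / 2) a) (intBall 0 (b + 1 / 3)), law n k t x y := by
  obtain ⟨x, hx⟩ := exists_few_hub_visits hk hn t
  refine ⟨x, ?_⟩
  set S := reach k x (intBall (t / 2) a) (intBall 0 (b + 1 / 3))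
  rw [sum_law_eq_mulVec_indicator]
  have hcompl : (fun v => if v ∈ S then (1 : ℝ) else 0)
      = 1 - fun v => if v ∈ S then (0 : ℝ) else 1 := by
    funext v
    simp only [Pi.sub_apply, Pi.one_apply]
    split_ifs <;> norm_num
  have hle := step_iterate_le hk hn x
    (f := fun v _ _ => if v ∈ S then (0 : ℝ) else 1)
    (g := fun v s j => 1 / a ^ 2 * ((s : ℝ) - t / 2) ^ 2
      + 1 / b ^ 2 * (j + corrector k v - corrector k x) ^ 2) (by
      intro v s j htr
      have h1 : 0 ≤ 1 / a ^ 2 * ((s : ℝ) - t / 2) ^ 2 := by positivity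
      have h2 : 0 ≤ 1 / b ^ 2 * (j + corrector k v - corrector k x) ^ 2 := by positivity
      split_ifs with hv
      · positivity
      · by_contra! hlt
        apply hv
        have key : ∀ {r y : ℝ}, 0 < r → 1 / r ^ 2 * y ^ 2 < 1 → |y| < r := by
          intro r y hr h
          rw [one_div_mul_eq_div, div_lt_one (by positivity)] at h
          exact abs_lt_of_sq_lt_sq h hr.le
        have hs := key ha (y := (s : ℝ) - t / 2) (by linarith)
        have hj := key hb (y := (j : ℝ) + corrector k v - corrector k x) (by linarith)
        refine mem_reach.2 ⟨s, mem_intBall hs, j, mem_intBall ?_, htr⟩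
        have hc : |corrector k v - corrector k x| ≤ 1 / 3 := by
          simp only [corrector]
          split_ifs <;> norm_num [abs_le]
        rw [abs_lt] at hj ⊢
        rw [abs_le] at hc
        constructor <;> linarith) t x 0 0 (by simp [Tracks])
  rw [step_iterate_vertex, step_iterate_sq] at hle
  beta_reduce at hle
  rw [hcompl, Matrix.mulVec_sub, transition_mulVec_one hk hn, Pi.sub_apply, Pi.one_apply]
  have hn0 : (0 : ℝ) < n := by
    have : 0 < n := by omega
    exact_mod_cast this
  have hB : 1 / b ^ 2 * (1 / 6 * ∑ i ∈ range t,
      (transition n k ^ i).mulVec (fun w => (jump k w : ℝ) ^ 2) x) ≤ t / (3 * n * b ^ 2) := by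
    calc _ ≤ 1 / b ^ 2 * (1 / 6 * (2 * t / n)) := by gcongr
      _ = _ := by field_simp; ring
  have hA : 1 / a ^ 2 * ((t : ℝ) / 4) = t / (4 * a ^ 2) := by field_simp
  have e : 1 / a ^ 2 * (((0 : ℤ) : ℝ) - t / 2 + t / 2) ^ 2 = 0 := by simp
  have e' : (((0 : ℤ) : ℝ) + corrector k x - corrector k x) ^ 2 = 0 := by simp
  rw [mul_add, e, zero_add, e', zero_add, hA] at hle
  linarith

lemma abs_sub_le_maxDist {n k t : ℕ} (x : Vertex n) (S : Finset (Vertex n)) :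
    |∑ y ∈ S, law n k t x y - (S.card : ℝ) / n| ≤ maxDist n k t := by
  rw [← sum_uniform]
  calc _ ≤ tvDist (law n k t x) (uniform n) :=
        le_ciSup (f := fun S : Finset (Vertex n) =>
          |∑ y ∈ S, law n k t x y - ∑ y ∈ S, uniform n y|) (Set.finite_range _).bddAbove S
    _ ≤ _ := le_ciSup (f := fun x : Vertex n => tvDist (law n k t x) (uniform n))
        (Set.finite_range _).bddAbove x

/-- Before time `n ^ (3 / 2) / 500`, some starting vertex leaves most of the mass on at most half of the vertices. -/
lemma lt_maxDist {n k t : ℕ} (hk : 2 ≤ k) (hn : k + 2 ≤ n) (hn16 : 16 ≤ n)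
    (ht : (t : ℝ) < 1 / 500 * (n : ℝ) ^ (3 / 2 : ℝ)) : 1 / 8 < maxDist n k t := by
  -- In terms of `q`, the windows have widths of order `q ^ 3` and `q`, and `n = q ^ 4`.
  set q : ℝ := (n : ℝ) ^ (1 / 4 : ℝ) with hq
  have hn0 : (0 : ℝ) ≤ n := Nat.cast_nonneg n
  have hq4 : q ^ 4 = n := by
    rw [hq, ← Real.rpow_natCast, ← Real.rpow_mul hn0]; norm_num
  have hq6 : (n : ℝ) ^ (3 / 2 : ℝ) = q ^ 6 := by
    rw [hq, ← Real.rpow_natCast, ← Real.rpow_mul hn0]; norm_num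
  have hq0 : 0 ≤ q := Real.rpow_nonneg hn0 _
  have hq2 : 2 ≤ q := by
    have : (2 : ℝ) ^ 4 ≤ q ^ 4 := by
      rw [hq4]; norm_num; exact_mod_cast hn16
    exact le_of_pow_le_pow_left₀ (by norm_num) hq0 this
  have hqpos : 0 < q := by linarith
  rw [hq6] at ht
  obtain ⟨x, hx⟩ := exists_law_reach hk hn t (a := q ^ 3 / 10) (b := q / 10) (by positivity)
    (by positivity)
  set A := intBall (t / 2 : ℝ) (q ^ 3 / 10)
  set B := intBall 0 (q / 10 + 1 / 3)
  have hA : (A.card : ℝ) ≤ 2 * (q ^ 3 / 10) + 1 := card_intBall_le (by positivity)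
  have hB : (B.card : ℝ) ≤ 2 * (q / 10 + 1 / 3) + 1 := card_intBall_le (by positivity)
  have hcard : ((reach k x A B).card : ℝ) ≤ A.card * B.card := by
    exact_mod_cast card_reach_le k x A B
  have hprod : (A.card : ℝ) * B.card ≤ q ^ 4 / 2 := by
    refine (mul_le_mul hA hB (by positivity) (by positivity)).trans ?_
    have h3 : 4 * q ≤ q ^ 3 := by nlinarith [mul_nonneg hq0 (mul_self_nonneg (q - 2))]
    have h4 : 2 * q ^ 3 ≤ q ^ 4 := by nlinarith [pow_pos hqpos 3]
    nlinarith
  have hfrac : ((reach k x A B).card : ℝ) / n ≤ 1 / 2 := by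
    rw [← hq4, div_le_iff₀ (by positivity)]
    linarith
  have hs : (t : ℝ) / (4 * (q ^ 3 / 10) ^ 2) ≤ 1 / 20 := by
    rw [div_le_iff₀ (by positivity)]
    nlinarith
  have hj : (t : ℝ) / (3 * n * (q / 10) ^ 2) ≤ 1 / 15 := by
    rw [← hq4, div_le_iff₀ (by positivity)]
    nlinarith
  have := (le_abs_self _).trans (abs_sub_le_maxDist (k := k) (t := t) x (reach k x A B))
  linarith

/-! ### Convergence to the uniform distribution -/

lemma transition_nonneg {n k : ℕ} (v w : Vertex n) : 0 ≤ transition n k v w := by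
  simp only [transition, Matrix.of_apply]
  split_ifs <;> norm_num

lemma transition_pow_nonneg {n k : ℕ} (t : ℕ) (v w : Vertex n) :
    0 ≤ (transition n k ^ t) v w := by
  induction t generalizing w with
  | zero => simp only [pow_zero, Matrix.one_apply]; split_ifs <;> norm_num
  | succ t ih =>
    rw [pow_succ, Matrix.mul_apply]
    exact sum_nonneg fun u _ => mul_nonneg (ih u) (transition_nonneg u w)

lemma transition_pow_succ_pos {n k t : ℕ} {v u w : Vertex n}
    (h : 0 < (transition n k ^ t) v u) (h' : 0 < transition n k u w) :
    0 < (transition n k ^ (t + 1)) v w := by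
  rw [pow_succ, Matrix.mul_apply]
  exact sum_pos' (fun u _ => mul_nonneg (transition_pow_nonneg t v u) (transition_nonneg u w))
    ⟨u, mem_univ _, mul_pos h h'⟩

lemma transition_pow_pos_iterate_next {n k : ℕ} (hk : 2 ≤ k) (hn : k + 2 ≤ n) (v : Vertex n)
    {d t : ℕ} (hd : d ≤ t) : 0 < (transition n k ^ t) v (next^[d] v) := by
  induction t generalizing d with
  | zero =>
    obtain rfl : d = 0 := by omega
    simp
  | succ t ih =>
    rcases Nat.lt_or_ge d (t + 1) with h | h
    · refine transition_pow_succ_pos (ih (by omega : d ≤ t)) ?_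
      rw [transition_apply hk hn, if_pos (rfl : next^[d] v = _)]
      split_ifs <;> norm_num
    · obtain rfl : d = t + 1 := by omega
      refine transition_pow_succ_pos (ih le_rfl) ?_
      rw [transition_apply hk hn, Function.iterate_succ_apply', if_pos rfl]
      split_ifs <;> norm_num

lemma iterate_next_val_of_le {n : ℕ} (v : Vertex n) {d : ℕ} (h : (v : ℕ) + d ≤ n) :
    (next^[d] v : ℕ) = v + d := by
  induction d with
  | zero => simp
  | succ d ih =>
    rw [Function.iterate_succ_apply', next_val, ih (by omega), if_neg (by omega)]
    rfl

lemma exists_iterate_next_eq {n : ℕ} (v w : Vertex n) : ∃ d ≤ n, next^[d] v = w := by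
  have hv := Finset.mem_Icc.1 v.2
  have hw := Finset.mem_Icc.1 w.2
  rcases le_or_gt (v : ℕ) w with h | h
  · exact ⟨w - v, by omega, Subtype.ext (by rw [iterate_next_val_of_le v (by omega)]; omega)⟩
  · have hone : (next (next^[n - v] v) : ℕ) = 1 := by
      rw [next_val, iterate_next_val_of_le v (by omega), if_pos (by omega)]
    refine ⟨(w - 1) + (n - v + 1), by omega, Subtype.ext ?_⟩
    rw [Function.iterate_add_apply, Function.iterate_succ_apply',
      iterate_next_val_of_le _ (by omega)]
    omega

/-- Doeblin contraction on functions of mean zero: replacing each entry `M v w` by `M v w - c`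
does not change the action on them. -/
lemma abs_mulVec_le_of_sum_eq_zero {V : Type*} [Fintype V] {M : Matrix V V ℝ} {c : ℝ}
    (hM : ∀ v w, c ≤ M v w) (hrow : ∀ v, ∑ w, M v w = 1) {f : V → ℝ} (hf : ∑ v, f v = 0)
    {K : ℝ} (hK : ∀ v, |f v| ≤ K) (v : V) :
    |M.mulVec f v| ≤ (1 - c * Fintype.card V) * K := by
  have h : M.mulVec f v = ∑ w, (M v w - c) * f w := by
    simp only [sub_mul, sum_sub_distrib, ← mul_sum, hf, Matrix.mulVec, dotProduct]
    ring
  rw [h]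
  calc _ ≤ ∑ w, |(M v w - c) * f w| := abs_sum_le_sum_abs _ _
    _ ≤ ∑ w, (M v w - c) * K := sum_le_sum fun w _ => by
        rw [abs_mul, abs_of_nonneg (sub_nonneg.2 (hM v w))]
        exact mul_le_mul_of_nonneg_left (hK w) (sub_nonneg.2 (hM v w))
    _ = _ := by
        rw [← sum_mul, sum_sub_distrib, hrow]
        simp [mul_comm]

lemma exists_maxDist_le {n k : ℕ} (hk : 2 ≤ k) (hn : k + 2 ≤ n) {ε : ℝ} (hε : 0 < ε) :
    ∃ t, maxDist n k t ≤ ε := by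
  have hne : Nonempty (Vertex n) := ⟨⟨n, Finset.mem_Icc.2 (by omega)⟩⟩
  have hn0 : (0 : ℝ) < n := by
    have : 0 < n := by omega
    exact_mod_cast this
  set M := transition n k ^ n
  obtain ⟨p, hp⟩ := Finite.exists_min fun p : Vertex n × Vertex n => M p.1 p.2
  set c := M p.1 p.2 with hc
  have hcpos : 0 < c := by
    obtain ⟨d, hd, h⟩ := exists_iterate_next_eq p.1 p.2
    rw [hc, ← h]
    exact transition_pow_pos_iterate_next hk hn p.1 hd
  have hM : ∀ v w, c ≤ M v w := fun v w => hp (v, w)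
  have hrow : ∀ v, ∑ w, M v w = 1 := fun v => by
    have := congrFun (transition_mulVec_one hk hn n) v
    simpa [Matrix.mulVec, dotProduct] using this
  set ρ : ℝ := 1 - c * n with hρ
  have hρ0 : 0 ≤ ρ := by
    have : ∑ _w : Vertex n, c ≤ ∑ w, M hne.some w := sum_le_sum fun w _ => hM _ w
    rw [hrow, sum_const, card_univ, card_vertex, nsmul_eq_mul] at this
    linarith
  have hρ1 : ρ < 1 := by
    have := mul_pos hcpos hn0
    linarith
  have hiter : ∀ (f : Vertex n → ℝ), ∑ v, f v = 0 → (∀ v, |f v| ≤ 1) → ∀ (m : ℕ) (v : Vertex n),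
      |(transition n k ^ (n * m)).mulVec f v| ≤ ρ ^ m := by
    intro f hf hf1 m
    induction m with
    | zero => simpa using hf1
    | succ m ih =>
      intro v
      rw [Nat.mul_succ, add_comm, pow_add, ← Matrix.mulVec_mulVec, pow_succ', hρ]
      have := abs_mulVec_le_of_sum_eq_zero hM hrow
        (f := (transition n k ^ (n * m)).mulVec f)
        (by rw [sum_transition_pow_mulVec hk hn, hf]) ih v
      rwa [card_vertex] at this
  obtain ⟨m, hm⟩ := exists_pow_lt_of_lt_one hε hρ1
  refine ⟨n * m, ciSup_le fun x => ciSup_le fun S => ?_⟩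
  rw [sum_uniform, sum_law_eq_mulVec_indicator]
  have hS0 : 0 ≤ (S.card : ℝ) / n := by positivity
  have hS1 : (S.card : ℝ) / n ≤ 1 := by
    rw [div_le_one hn0]
    have := S.card_le_univ
    rw [card_vertex] at this
    exact_mod_cast this
  have h := hiter ((fun v => if v ∈ S then 1 else 0) - ((S.card : ℝ) / n) • 1)
    (by
      simp only [Pi.sub_apply, Pi.smul_apply, Pi.one_apply, smul_eq_mul, mul_one, sum_sub_distrib,
        sum_const, card_univ, card_vertex, nsmul_eq_mul, sum_ite_mem, univ_inter]
      field_simp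
      ring)
    (by
      intro v
      simp only [Pi.sub_apply, Pi.smul_apply, Pi.one_apply, smul_eq_mul, mul_one]
      rw [abs_le]
      split_ifs <;> constructor <;> linarith) m x
  rw [Matrix.mulVec_sub, Matrix.mulVec_smul, transition_mulVec_one hk hn] at h
  simp only [Pi.sub_apply, Pi.smul_apply, Pi.one_apply, smul_eq_mul, mul_one] at h
  exact h.trans hm.le

end CycleChain

theorem theorem2 :
    ∃ γ ε : ℝ, 0 < γ ∧ 0 < ε ∧
      ∀ᶠ n : ℕ in Filter.atTop, ∀ k : ℕ, 2 ≤ k → k + 2 ≤ n →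
        γ * (n : ℝ) ^ (3 / 2 : ℝ) ≤ (CycleChain.mixingTime n k ε : ℝ) := by
  refine ⟨1 / 500, 1 / 8, by norm_num, by norm_num, ?_⟩
  filter_upwards [Filter.eventually_ge_atTop 16] with n hn16 k hk hn
  -- The infimum over an empty set would be the junk value `0`: the mixing time must be attained.
  have hmem : CycleChain.maxDist n k (CycleChain.mixingTime n k (1 / 8)) ≤ 1 / 8 :=
    Nat.sInf_mem (s := {t | CycleChain.maxDist n k t ≤ 1 / 8})
      (CycleChain.exists_maxDist_le hk hn (by norm_num))
  by_contra! hlt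
  exact absurd hmem (not_le.2 (CycleChain.lt_maxDist hk hn hn16 hlt))
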